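/- **Theorem 3.7.** All multigraphs are finite, undirected and loopless, and may have multiple edges. *Graph algebras.* For $k\ge 0$, a $k$-labeled multigraph is a multigraph in which $k$ different vertices are labeled $1,\dots,k$. Let $\mathcal G_k$ be the set of isomorphism classes of $k$-labeled multigraphs (isomorphisms respect the labels). It is a commutative monoid under the product that takes the disjoint union of two graphs and identifies vertices with the same label (edge multiplicities add up); the identity is the graph with vertices $1,\dots,k$ and no edges. Let $\mathcal A_k=\mathbb R[\mathcal G_k]$ be the monoid algebra, and $\mathcal A_k^0\subseteq\mathcal A_k$ the subalgebra spanned by the graphs all of whose vertices are labeled. A *quantum multigraph* is an element of $\mathcal A_0$, i.e. a finite formal real linear combination of (isomorphism classes of) unlabeled multigraphs; $1\in\mathcal A_0$ is the empty graph. Write $K_1$ for the one-vertex graph and $K_2^m$ for the graph with two vertices and $m$ edges between them. *Graph parameters.* A graph parameter is a map $t\colon\mathcal G_0\to\mathbb R$; it is extended linearly to $\mathcal A_0$, and to each $\mathcal A_k$ by forgetting the labels. It is called *isolate indifferent* if $t(G\sqcup K_1)=t(G)$ for all $G\in\mathcal G_0$, *flatly reflection positive* if $t(b^2)\ge 0$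 for all $k\ge 0$ and all $b\in\mathcal A_k^0$, and *$d$-bounded* if $|t(K_2^m)|\le d^m$ for all $m\ge 0$. *Coincidence.* A quantum multigraph $c\in\mathcal A_0$ and an element $\sigma\in\mathcal A_k$ coincide up to labels and isolated vertices if the difference of $c$ and the quantum multigraph obtained from $\sigma$ by forgetting all labels lies in the linear span of the elements $(G\sqcup K_1)-G$, $G\in\mathcal G_0$. *Statement.* Let $d>0$ be a real number and let $a$ be a quantum multigraph. Then $t(a)\ge 0$ holds for every isolate indifferent, flatly reflection positive and $d$-bounded graph parameter $t$ if and only if for every $\epsilon>0$ there exist $r\in\mathbb N$ (with $0\in\mathbb N$) and a sum of squares $\sigma$ of elements of $\mathcal A_r^0$ such that $$a+\epsilon\left(1+\frac1{d^{2r}}K_2^{2r}\right)$$ and $\sigma$ coincide up to labels and isolated vertices. -/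

import Mathlib

noncomputable section

/-- A finite, undirected, loopless multigraph with `k` vertices labeled by `Fin k`. The vertex set is
`Fin k ⊕ Free`, where `Free` is the set of unlabeled vertices (every `k`-labeled multigraph has this
form up to isomorphism); `mult x y` is the number of edges between `x` and `y`. -/
structure LabeledMultigraph (k : ℕ) where
  Free : Type
  finite_free : Finite Free
  mult : Fin k ⊕ Free → Fin k ⊕ Free → ℕ
  symm : ∀ x y, mult x y = mult y x
  loopless : ∀ x, mult x x = 0

namespace LabeledMultigraph

variable {k : ℕ}

/-- Isomorphism of `k`-labeled multigraphs: a bijection of the vertices that fixes every label and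
preserves edge multiplicities. -/
def Iso (G H : LabeledMultigraph k) : Prop :=
  ∃ e : G.Free ≃ H.Free, ∀ x y, H.mult (Sum.map id e x) (Sum.map id e y) = G.mult x y

theorem Iso.refl (G : LabeledMultigraph k) : Iso G G :=
  ⟨Equiv.refl _, fun x y => by simp⟩

theorem Iso.symm {G H : LabeledMultigraph k} : Iso G H → Iso H G := by
  rintro ⟨e, he⟩
  exact ⟨e.symm, fun x y => by rw [← he]; simp⟩

theorem Iso.trans {G H K : LabeledMultigraph k} : Iso G H → Iso H K → Iso G K := by
  rintro ⟨e, he⟩ ⟨f, hf⟩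
  refine ⟨e.trans f, fun x y => ?_⟩
  rw [← he, ← hf]
  simp

instance setoid (k : ℕ) : Setoid (LabeledMultigraph k) :=
  ⟨Iso, Iso.refl, Iso.symm, Iso.trans⟩

/-- The edgeless graph `E_k` with vertices `1, …, k`. -/
def edgeless (k : ℕ) : LabeledMultigraph k where
  Free := PEmpty
  finite_free := inferInstance
  mult _ _ := 0
  symm _ _ := rfl
  loopless _ := rfl

/-- Extends an edge multiplicity by zero: there are no edges at vertices `none` outside the graph. -/
def extendMult {V : Type} (m : V → V → ℕ) : Option V → Option V → ℕ
  | some x, some y => m x y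
  | _, _ => 0

/-- A vertex of the glued graph, seen as a vertex of the left factor if it is one. -/
def toLeft {k : ℕ} {A B : Type} : Fin k ⊕ (A ⊕ B) → Option (Fin k ⊕ A)
  | .inl i => some (.inl i)
  | .inr (.inl a) => some (.inr a)
  | .inr (.inr _) => none

/-- A vertex of the glued graph, seen as a vertex of the right factor if it is one. -/
def toRight {k : ℕ} {A B : Type} : Fin k ⊕ (A ⊕ B) → Option (Fin k ⊕ B)
  | .inl i => some (.inl i)
  | .inr (.inl _) => none
  | .inr (.inr b) => some (.inr b)

/-- The edge multiplicities of a graph glued along its labeled vertices: those of the factors add. -/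
def glueMult {k : ℕ} {A B : Type} (m : Fin k ⊕ A → Fin k ⊕ A → ℕ) (n : Fin k ⊕ B → Fin k ⊕ B → ℕ)
    (x y : Fin k ⊕ (A ⊕ B)) : ℕ :=
  extendMult m (toLeft x) (toLeft y) + extendMult n (toRight x) (toRight y)

/-- The gluing product: take the disjoint union and identify vertices with the same label; the edge
multiplicities add up. -/
def glue (G H : LabeledMultigraph k) : LabeledMultigraph k where
  Free := G.Free ⊕ H.Free
  finite_free := by
    have := G.finite_free
    have := H.finite_free
    infer_instance
  mult := glueMult G.mult H.mult
  symm x y := by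
    have hG := G.symm
    have hH := H.symm
    rcases x with i | a | b <;> rcases y with j | c | d <;>
      simp only [glueMult, extendMult, toLeft, toRight]
    all_goals first | rw [hG, hH] | rw [hG] | rw [hH]
  loopless x := by
    rcases x with i | a | b <;>
      simp [glueMult, extendMult, toLeft, toRight, G.loopless, H.loopless]

theorem glueMult_map {A A' B B' : Type} (m : Fin k ⊕ A' → Fin k ⊕ A' → ℕ)
    (n : Fin k ⊕ B' → Fin k ⊕ B' → ℕ) (e : A → A') (f : B → B') (x y : Fin k ⊕ (A ⊕ B)) :
    glueMult m n (Sum.map id (Sum.map e f) x) (Sum.map id (Sum.map e f) y) =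
      glueMult (fun u v => m (Sum.map id e u) (Sum.map id e v))
        (fun u v => n (Sum.map id f u) (Sum.map id f v)) x y := by
  rcases x with i | a | b <;> rcases y with j | c | d <;> rfl

theorem glueMult_swap {A B : Type} (m : Fin k ⊕ A → Fin k ⊕ A → ℕ)
    (n : Fin k ⊕ B → Fin k ⊕ B → ℕ) (x y : Fin k ⊕ (A ⊕ B)) :
    glueMult n m (Sum.map id Sum.swap x) (Sum.map id Sum.swap y) = glueMult m n x y := by
  rcases x with i | a | b <;> rcases y with j | c | d <;> exact add_comm _ _

theorem glueMult_assoc {A B C : Type} (l : Fin k ⊕ A → Fin k ⊕ A → ℕ)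
    (m : Fin k ⊕ B → Fin k ⊕ B → ℕ) (n : Fin k ⊕ C → Fin k ⊕ C → ℕ)
    (x y : Fin k ⊕ ((A ⊕ B) ⊕ C)) :
    glueMult l (glueMult m n) (Sum.map id (Equiv.sumAssoc A B C) x)
      (Sum.map id (Equiv.sumAssoc A B C) y) = glueMult (glueMult l m) n x y := by
  rcases x with i | (a | b) | c <;> rcases y with i' | (a' | b') | c' <;>
    simp [glueMult, extendMult, toLeft, toRight, add_assoc]

theorem glueMult_empty {B : Type} (n : Fin k ⊕ B → Fin k ⊕ B → ℕ) (x y : Fin k ⊕ (PEmpty ⊕ B)) :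
    n (Sum.map id (Equiv.emptySum PEmpty B) x) (Sum.map id (Equiv.emptySum PEmpty B) y) =
      glueMult (fun _ _ : Fin k ⊕ PEmpty => 0) n x y := by
  rcases x with i | ⟨⟨⟩⟩ | b <;> rcases y with j | ⟨⟨⟩⟩ | d <;> exact (zero_add _).symm

theorem glue_congr {G G' H H' : LabeledMultigraph k} :
    Iso G G' → Iso H H' → Iso (glue G H) (glue G' H') := by
  rintro ⟨e, he⟩ ⟨f, hf⟩
  refine ⟨Equiv.sumCongr e f, fun x y => (glueMult_map _ _ e f x y).trans ?_⟩
  simp only [he, hf]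
  rfl

theorem glue_comm (G H : LabeledMultigraph k) : Iso (glue G H) (glue H G) :=
  ⟨Equiv.sumComm _ _, fun x y => glueMult_swap G.mult H.mult x y⟩

theorem glue_assoc (G H K : LabeledMultigraph k) :
    Iso (glue (glue G H) K) (glue G (glue H K)) :=
  ⟨Equiv.sumAssoc _ _ _, fun x y => glueMult_assoc G.mult H.mult K.mult x y⟩

theorem edgeless_glue (G : LabeledMultigraph k) : Iso (glue (edgeless k) G) G :=
  ⟨Equiv.emptySum PEmpty _, fun x y => glueMult_empty G.mult x y⟩

/-- The degree of a `k`-labeled multigraph: the number of its unlabeled vertices. -/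
def degree (G : LabeledMultigraph k) : ℕ := Nat.card G.Free

/-- Forgetting the labels: all vertices become unlabeled. -/
def unlabel (G : LabeledMultigraph k) : LabeledMultigraph 0 where
  Free := Fin k ⊕ G.Free
  finite_free := by
    have := G.finite_free
    infer_instance
  mult x y := G.mult (Sum.elim Fin.elim0 id x) (Sum.elim Fin.elim0 id y)
  symm x y := G.symm _ _
  loopless x := G.loopless _

theorem unlabel_congr {G H : LabeledMultigraph k} : Iso G H → Iso (unlabel G) (unlabel H) := by
  rintro ⟨e, he⟩
  refine ⟨Equiv.sumCongr (Equiv.refl _) e, ?_⟩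
  rintro (i | x) (j | y)
  · exact i.elim0
  · exact i.elim0
  · exact j.elim0
  · exact he x y

/-- The unlabeled graph `K_1`: a single vertex. -/
def singleVertex : LabeledMultigraph 0 where
  Free := PUnit
  finite_free := inferInstance
  mult _ _ := 0
  symm _ _ := rfl
  loopless _ := rfl

/-- The unlabeled multigraph `K_2^m`: two vertices with `m` edges between them. -/
def multiEdge (m : ℕ) : LabeledMultigraph 0 where
  Free := Bool
  finite_free := inferInstance
  mult x y := if x = y then 0 else m
  symm x y := by simp [eq_comm]
  loopless x := by simp

end LabeledMultigraph

/-- `𝒢_k`: isomorphism classes of `k`-labeled multigraphs. -/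
def GraphClass (k : ℕ) : Type 1 := Quotient (LabeledMultigraph.setoid k)

namespace GraphClass

variable {k : ℕ}

/-- The isomorphism class of a `k`-labeled multigraph. -/
def mk (G : LabeledMultigraph k) : GraphClass k := Quotient.mk _ G

/-- `𝒢_k` is a commutative monoid under the gluing product, with identity `E_k`. -/
instance (k : ℕ) : CommMonoid (GraphClass k) where
  mul := Quotient.map₂ LabeledMultigraph.glue
    fun _ _ h _ _ h' => LabeledMultigraph.glue_congr h h'
  one := mk (LabeledMultigraph.edgeless k)
  mul_assoc := by
    rintro ⟨G⟩ ⟨H⟩ ⟨K⟩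
    exact Quotient.sound (LabeledMultigraph.glue_assoc G H K)
  mul_comm := by
    rintro ⟨G⟩ ⟨H⟩
    exact Quotient.sound (LabeledMultigraph.glue_comm G H)
  one_mul := by
    rintro ⟨G⟩
    exact Quotient.sound (LabeledMultigraph.edgeless_glue G)
  mul_one := by
    rintro ⟨G⟩
    exact Quotient.sound
      ((LabeledMultigraph.glue_comm _ _).trans (LabeledMultigraph.edgeless_glue G))

/-- The number of unlabeled vertices. -/
def degree : GraphClass k → ℕ :=
  Quotient.lift LabeledMultigraph.degree fun _ _ ⟨e, _⟩ => Nat.card_congr e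

theorem degree_one : degree (1 : GraphClass k) = 0 :=
  Nat.card_eq_zero.2 (Or.inl (inferInstanceAs (IsEmpty PEmpty)))

theorem degree_mul (G H : GraphClass k) : degree (G * H) = degree G + degree H := by
  rcases G with ⟨G⟩
  rcases H with ⟨H⟩
  have := G.finite_free
  have := H.finite_free
  exact Nat.card_sum

/-- Forgetting the labels, `𝒢_k → 𝒢_0`. -/
def unlabel : GraphClass k → GraphClass 0 :=
  Quotient.map LabeledMultigraph.unlabel fun _ _ h => LabeledMultigraph.unlabel_congr h

/-- The class of `K_1`. -/
def singleVertex : GraphClass 0 := mk LabeledMultigraph.singleVertex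

/-- The class of `K_2^m`. -/
def multiEdge (m : ℕ) : GraphClass 0 := mk (LabeledMultigraph.multiEdge m)

end GraphClass

/-- The graph algebra `𝒜_k`: the monoid algebra of `𝒢_k` over `ℝ`. -/
abbrev GraphAlgebra (k : ℕ) : Type 1 := MonoidAlgebra ℝ (GraphClass k)

/-- Quantum multigraphs: formal real linear combinations of unlabeled multigraphs. -/
abbrev QuantumMultigraph : Type 1 := GraphAlgebra 0

namespace GraphAlgebra

/-- The homogeneous part `𝒜_k^n`, spanned by the graphs with exactly `n` unlabeled vertices. -/
def gradedPart (k n : ℕ) : Submodule ℝ (GraphAlgebra k) :=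
  MonoidAlgebra.supported ℝ ℝ {G | G.degree = n}

theorem one_mem_gradedPart (k : ℕ) : (1 : GraphAlgebra k) ∈ gradedPart k 0 := by
  rw [gradedPart, MonoidAlgebra.supported_eq_span_single]
  exact Submodule.subset_span ⟨1, GraphClass.degree_one, rfl⟩

theorem mul_mem_gradedPart {k m n : ℕ} {a b : GraphAlgebra k}
    (ha : a ∈ gradedPart k m) (hb : b ∈ gradedPart k n) : a * b ∈ gradedPart k (m + n) := by
  rw [gradedPart, MonoidAlgebra.supported_eq_span_single] at ha hb ⊢
  have h := Submodule.mul_mem_mul ha hb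
  rw [Submodule.span_mul_span] at h
  refine Submodule.span_mono ?_ h
  rintro _ ⟨_, ⟨G, hG, rfl⟩, _, ⟨H, hH, rfl⟩, rfl⟩
  refine ⟨G * H, ?_, ?_⟩
  · exact (GraphClass.degree_mul G H).trans (congrArg₂ _ hG hH)
  · simp

/-- The subalgebra `𝒜_k^0` of `𝒜_k`, spanned by the fully labeled graphs. -/
def flat (k : ℕ) : Subalgebra ℝ (GraphAlgebra k) :=
  (gradedPart k 0).toSubalgebra (one_mem_gradedPart k) fun _ _ => mul_mem_gradedPart

/-- Forgetting the labels, extended linearly to `𝒜_k → 𝒜_0`. -/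
def unlabel (k : ℕ) : GraphAlgebra k →ₗ[ℝ] QuantumMultigraph :=
  MonoidAlgebra.mapDomainLinearMap ℝ ℝ GraphClass.unlabel

/-- The subspace of `𝒜_0` spanned by the differences `G ⊔ K_1 - G`: two quantum multigraphs agree
up to isolated vertices if and only if their difference lies in it. -/
def isolatedVertexSpan : Submodule ℝ QuantumMultigraph :=
  Submodule.span ℝ (Set.range fun G : GraphClass 0 =>
    MonoidAlgebra.of ℝ (GraphClass 0) (G * GraphClass.singleVertex) -
      MonoidAlgebra.of ℝ (GraphClass 0) G)

/-- `a` and `σ` coincide up to labels and isolated vertices: after removal of the labels of `σ`, one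
is obtained from the other by adding or removing isolated vertices in the terms. -/
def Coincide {k : ℕ} (a : QuantumMultigraph) (σ : GraphAlgebra k) : Prop :=
  a - unlabel k σ ∈ isolatedVertexSpan

end GraphAlgebra

/-- A graph parameter assigns a real number to each isomorphism class of unlabeled multigraphs. -/
abbrev GraphParameter : Type 1 := GraphClass 0 → ℝ

namespace GraphParameter

/-- The linear extension of a graph parameter to quantum multigraphs. -/
def eval (t : GraphParameter) : QuantumMultigraph →ₗ[ℝ] ℝ :=
  Finsupp.linearCombination ℝ t ∘ₗ (MonoidAlgebra.coeffLinearEquiv ℝ).toLinearMap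

/-- The value does not change when an isolated vertex is added. -/
def IsolateIndifferent (t : GraphParameter) : Prop :=
  ∀ G : GraphClass 0, t (G * GraphClass.singleVertex) = t G

/-- `t(a²) ≥ 0` for all `k` and all `a ∈ 𝒜_k^0`, where `t` is applied after forgetting labels. -/
def FlatlyReflectionPositive (t : GraphParameter) : Prop :=
  ∀ k : ℕ, ∀ a ∈ GraphAlgebra.flat k, 0 ≤ t.eval (GraphAlgebra.unlabel k (a ^ 2))

/-- `|t(K_2^m)| ≤ d^m` for all `m`. -/
def Bounded (d : ℝ) (t : GraphParameter) : Prop :=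
  ∀ m : ℕ, |t (GraphClass.multiEdge m)| ≤ d ^ m

end GraphParameter

end

/-! Write `edgeBound d r` for 1 + d^{-2r} K_2^{2r}. The right-hand side of the equivalence says that
`a` lies in `approxCone d`, so the theorem is a duality statement for this convex cone.

If `a` lies in the cone, evaluate: a parameter `t` as in the statement is nonnegative on sums of
squares and gives `edgeBound d r` a value of at most 2, so `t.eval a ≥ -2ε` for every ε.

Conversely, suppose `a` is not in the cone. The cone is closed in the direction of 1
(`mem_approxCone_of_forall_add`), so some a + ε·1 is not in it either. Since 1 is an order unit
(`boundedSubmodule_eq_top`), M. Riesz extension gives a linear functional L, nonnegative on the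
cone, with L 1 = 1 and L(a + ε·1) ≤ 0. Its values on graphs form an admissible parameter that is
negative on `a`. It is d-bounded because 1 ± d^{-m} K_2^m lies in the cone; this reduces to
sum-of-squares identities in one variable y, with y = edge/d.

The order unit property comes from the same bounds for single edges, extended to products of edges
by a Cauchy–Schwarz argument. -/

noncomputable section

/-! ### Labeled multigraphs: extra labels, isolated vertices, decomposition into edges -/

namespace LabeledMultigraph

variable {k : ℕ}

theorem extendMult_symm {V : Type} {m : V → V → ℕ} (h : ∀ x y, m x y = m y x) (x y : Option V) :
    extendMult m x y = extendMult m y x := by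
  rcases x with _ | x <;> rcases y with _ | y <;> first | rfl | exact h x y

theorem extendMult_self {V : Type} {m : V → V → ℕ} (h : ∀ x, m x x = 0) (x : Option V) :
    extendMult m x x = 0 := by
  rcases x with _ | x
  · rfl
  · exact h x

theorem extendMult_map {V W : Type} (m : W → W → ℕ) (f : V → W) (x y : Option V) :
    extendMult m (x.map f) (y.map f) = extendMult (fun u v => m (f u) (f v)) x y := by
  rcases x with _ | x <;> rcases y with _ | y <;> rfl

/-- The edgeless unlabeled graph on a finite type of vertices. -/
def isolated (W : Type) [Finite W] : LabeledMultigraph 0 where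
  Free := W
  finite_free := inferInstance
  mult _ _ := 0
  symm _ _ := rfl
  loopless _ := rfl

/-- A vertex of a graph with an additional label, seen as a vertex of the original graph if it is
one. -/
def dropLabel {A : Type} : Fin (k + 1) ⊕ A → Option (Fin k ⊕ A)
  | .inl i => Fin.lastCases (motive := fun _ => Option (Fin k ⊕ A)) none (fun j => some (.inl j)) i
  | .inr a => some (.inr a)

@[simp]
theorem dropLabel_inl_last {A : Type} :
    dropLabel (.inl (Fin.last k) : Fin (k + 1) ⊕ A) = none := by
  simp [dropLabel]

@[simp]
theorem dropLabel_inl_castSucc {A : Type} (i : Fin k) :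
    dropLabel (.inl i.castSucc : Fin (k + 1) ⊕ A) = some (.inl i) := by
  simp [dropLabel]

@[simp]
theorem dropLabel_inr {A : Type} (a : A) :
    dropLabel (.inr a : Fin (k + 1) ⊕ A) = some (.inr a) := rfl

theorem dropLabel_map {A B : Type} (e : A → B) (x : Fin (k + 1) ⊕ A) :
    dropLabel (Sum.map id e x) = (dropLabel x).map (Sum.map id e) := by
  rcases x with i | a
  · induction i using Fin.lastCases <;> simp
  · rfl

/-- Adds an isolated vertex with a new label. -/
def addLabel (G : LabeledMultigraph k) : LabeledMultigraph (k + 1) where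
  Free := G.Free
  finite_free := G.finite_free
  mult x y := extendMult G.mult (dropLabel x) (dropLabel y)
  symm _ _ := extendMult_symm G.symm _ _
  loopless _ := extendMult_self G.loopless _

theorem addLabel_congr {G H : LabeledMultigraph k} : Iso G H → Iso (addLabel G) (addLabel H) := by
  rintro ⟨e, he⟩
  exact ⟨e, fun x y => (congrArg₂ (extendMult H.mult) (dropLabel_map e x) (dropLabel_map e y)).trans
    ((extendMult_map _ _ _ _).trans (by simp only [he]; rfl))⟩

theorem addLabel_edgeless : Iso (addLabel (edgeless k)) (edgeless (k + 1)) := by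
  refine ⟨Equiv.refl _, fun x y => ?_⟩
  change 0 = extendMult (fun _ _ => 0) (dropLabel x) (dropLabel y)
  rcases dropLabel x with _ | x <;> rcases dropLabel y with _ | y <;> rfl

theorem extendMult_glueMult {A B : Type} (m : Fin k ⊕ A → Fin k ⊕ A → ℕ)
    (n : Fin k ⊕ B → Fin k ⊕ B → ℕ) (x y : Fin (k + 1) ⊕ (A ⊕ B)) :
    extendMult (glueMult m n) (dropLabel x) (dropLabel y) =
      glueMult (fun x y => extendMult m (dropLabel x) (dropLabel y))
        (fun x y => extendMult n (dropLabel x) (dropLabel y)) x y := by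
  rcases x with i | a | a <;> rcases y with j | b | b <;>
    (try induction i using Fin.lastCases) <;> (try induction j using Fin.lastCases) <;>
    simp [glueMult, extendMult, toLeft, toRight]

theorem addLabel_glue (G H : LabeledMultigraph k) :
    Iso (addLabel (glue G H)) (glue (addLabel G) (addLabel H)) := by
  refine ⟨Equiv.refl _, fun x y => .trans ?_ (extendMult_glueMult G.mult H.mult x y).symm⟩
  rcases x with x | x <;> rcases y with y | y <;> rfl

/-- The vertices of a graph with an additional label are those of the original graph and one more. -/
def dropLabelEquiv (k : ℕ) (A : Type) : Fin (k + 1) ⊕ A ≃ (Fin k ⊕ A) ⊕ PUnit.{1} where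
  toFun x := (dropLabel x).elim (.inr ⟨⟩) .inl
  invFun := Sum.elim (Sum.map Fin.castSucc id) fun _ => .inl (Fin.last k)
  left_inv x := by
    rcases x with i | a
    · induction i using Fin.lastCases <;> simp
    · simp
  right_inv x := by
    rcases x with (i | a) | _ <;> simp

theorem unlabel_addLabel (G : LabeledMultigraph k) :
    Iso (unlabel (addLabel G)) (glue (unlabel G) singleVertex) := by
  refine ⟨dropLabelEquiv k G.Free, fun x y => ?_⟩
  rcases x with i | x
  · exact i.elim0
  rcases y with j | y
  · exact j.elim0
  have h (u v : Option (Fin k ⊕ G.Free)) : (glue (unlabel G) singleVertex).mult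
      (.inr (u.elim (.inr ⟨⟩) .inl)) (.inr (v.elim (.inr ⟨⟩) .inl)) = extendMult G.mult u v := by
    rcases u with _ | x <;> rcases v with _ | y <;> rfl
  exact h _ _

variable (k) in
/-- Edge multiplicities of loopless multigraphs on `Fin k`. -/
def flatMult : AddSubmonoid (Fin k → Fin k → ℕ) where
  carrier := {m | (∀ x y, m x y = m y x) ∧ ∀ x, m x x = 0}
  zero_mem' := ⟨fun _ _ => rfl, fun _ => rfl⟩
  add_mem' := fun hm hn => ⟨fun x y => congrArg₂ (· + ·) (hm.1 x y) (hn.1 x y),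
    fun x => by simp [hm.2, hn.2]⟩

/-- The fully labeled multigraph with given edge multiplicities. -/
def ofMult (m : flatMult k) : LabeledMultigraph k where
  Free := PEmpty
  finite_free := inferInstance
  mult x y := m.1 (Sum.elim id PEmpty.elim x) (Sum.elim id PEmpty.elim y)
  symm _ _ := m.2.1 _ _
  loopless _ := m.2.2 _

theorem ofMult_add (m n : flatMult k) : Iso (glue (ofMult m) (ofMult n)) (ofMult (m + n)) := by
  refine ⟨Equiv.sumEmpty PEmpty PEmpty, fun x y => ?_⟩
  rcases x with i | ⟨⟨⟩⟩ | ⟨⟨⟩⟩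
  rcases y with j | ⟨⟨⟩⟩ | ⟨⟨⟩⟩
  rfl

variable (k) in
/-- One edge between the vertices `i` and `j`, if they are different. -/
def edgeMult (i j : Fin k) : flatMult k :=
  ⟨fun x y => if x ≠ y ∧ (x = i ∧ y = j ∨ x = j ∧ y = i) then 1 else 0,
    fun x y => if_congr (by tauto) rfl rfl, fun x => by simp⟩

/-- The vertices other than two given ones. -/
def restEquiv {i j : Fin k} (h : i ≠ j) :
    Bool ⊕ {x : Fin k // x ≠ i ∧ x ≠ j} ≃ Fin k where
  toFun := Sum.elim (fun b => if b then i else j) Subtype.val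
  invFun x := if hi : x = i then .inl true else if hj : x = j then .inl false else .inr ⟨x, hi, hj⟩
  left_inv x := by
    rcases x with (_ | _) | ⟨x, hi, hj⟩
    · simp [h.symm]
    · simp
    · simp [hi, hj]
  right_inv x := by
    by_cases hi : x = i
    · simp [hi]
    · by_cases hj : x = j
      · subst hj
        simp [h.symm]
      · simp [hi, hj]

theorem unlabel_edgeMult {i j : Fin k} (h : i ≠ j) (n : ℕ) :
    Iso (glue (multiEdge n) (isolated {x : Fin k // x ≠ i ∧ x ≠ j}))
      (unlabel (ofMult (n • edgeMult k i j))) := by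
  refine ⟨(restEquiv h).trans (Equiv.sumEmpty _ PEmpty).symm, fun x y => ?_⟩
  rcases x with x | x
  · exact x.elim0
  rcases y with y | y
  · exact y.elim0
  change n • (if restEquiv h x ≠ restEquiv h y ∧ (restEquiv h x = i ∧ restEquiv h y = j ∨
    restEquiv h x = j ∧ restEquiv h y = i) then 1 else 0) = glueMult (k := 0) _ _ (.inr x) (.inr y)
  rcases x with (_ | _) | ⟨x, hx, hx'⟩ <;> rcases y with (_ | _) | ⟨y, hy, hy'⟩ <;>
    simp_all [restEquiv, glueMult, toLeft, toRight, extendMult, multiEdge, isolated, h.symm]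

theorem exists_iso_ofMult {G : LabeledMultigraph k} (hG : G.degree = 0) :
    ∃ m : flatMult k, Iso G (ofMult m) := by
  have := G.finite_free
  have : IsEmpty G.Free := (Nat.card_eq_zero.1 hG).resolve_right fun h => h.not_finite this
  refine ⟨⟨fun x y => G.mult (.inl x) (.inl y), fun x y => G.symm _ _, fun x => G.loopless _⟩,
    Equiv.equivPEmpty _, fun x y => ?_⟩
  rcases x with x | x
  · rcases y with y | y
    · rfl
    · exact isEmptyElim y
  · exact isEmptyElim x

theorem exists_iso_unlabel_ofMult (G : LabeledMultigraph 0) :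
    ∃ (k : ℕ) (m : flatMult k), Iso G (unlabel (ofMult m)) := by
  have := G.finite_free
  obtain ⟨k, ⟨e⟩⟩ := Finite.exists_equiv_fin G.Free
  refine ⟨k, ⟨fun x y => G.mult (.inr (e.symm x)) (.inr (e.symm y)), fun x y => G.symm _ _,
    fun x => G.loopless _⟩, e.trans (Equiv.sumEmpty _ PEmpty).symm, fun x y => ?_⟩
  rcases x with x | x
  · exact x.elim0
  rcases y with y | y
  · exact y.elim0
  change G.mult (.inr (e.symm (e x))) (.inr (e.symm (e y))) = _
  simp

/-- Remove one edge at a time, by strong induction on the sum of all multiplicities. -/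
theorem flatMult_mem_closure (m : flatMult k) :
    m ∈ AddSubmonoid.closure {n | ∃ i j, i ≠ j ∧ n = edgeMult k i j} := by
  induction hs : ∑ x, ∑ y, m.1 x y using Nat.strong_induction_on generalizing m with
  | _ s ih =>
  by_cases h0 : m = 0
  · exact h0 ▸ zero_mem _
  obtain ⟨i, j, hij⟩ : ∃ i j, m.1 i j ≠ 0 := by
    by_contra! h
    exact h0 (Subtype.ext (funext₂ h))
  have hne : i ≠ j := fun h => hij (h ▸ m.2.2 i)
  -- The truncated subtraction is exact, since the removed edge is present in `m`; this is checked
  -- in `hm`.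
  let m' : flatMult k := ⟨fun x y => m.1 x y - (edgeMult k i j).1 x y,
    fun x y => congrArg₂ (· - ·) (m.2.1 x y) ((edgeMult k i j).2.1 x y), fun x => by simp [m.2.2]⟩
  have hm : m = m' + edgeMult k i j := by
    refine Subtype.ext (funext₂ fun x y => ?_)
    change m.1 x y = m.1 x y - (edgeMult k i j).1 x y + (edgeMult k i j).1 x y
    refine (Nat.sub_add_cancel ?_).symm
    change (if _ then _ else _) ≤ _
    split_ifs with hc
    · rcases hc.2 with ⟨rfl, rfl⟩ | ⟨rfl, rfl⟩
      · exact Nat.one_le_iff_ne_zero.2 hij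
      · exact Nat.one_le_iff_ne_zero.2 (m.2.1 x y ▸ hij)
    · exact Nat.zero_le _
  rw [hm]
  refine add_mem (ih _ ?_ m' rfl) (AddSubmonoid.subset_closure ⟨i, j, hne, rfl⟩)
  rw [← hs]
  have hle : ∀ x y, m'.1 x y ≤ m.1 x y := fun x y => Nat.sub_le _ _
  refine Finset.sum_lt_sum (fun x _ => Finset.sum_le_sum fun y _ => hle x y)
    ⟨i, Finset.mem_univ _, Finset.sum_lt_sum (fun y _ => hle i y) ⟨j, Finset.mem_univ _, ?_⟩⟩
  change m.1 i j - (if _ then _ else _) < _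
  rw [if_pos ⟨hne, Or.inl ⟨rfl, rfl⟩⟩]
  omega

end LabeledMultigraph

/-! ### The monoids of isomorphism classes -/

namespace GraphClass

open LabeledMultigraph (flatMult edgeMult)

variable {k : ℕ}

theorem mk_eq {G H : LabeledMultigraph k} (h : LabeledMultigraph.Iso G H) : mk G = mk H :=
  Quotient.sound h

/-- Adding an isolated vertex with a new label is a homomorphism. -/
def addLabel (k : ℕ) : GraphClass k →* GraphClass (k + 1) where
  toFun := Quotient.map LabeledMultigraph.addLabel fun _ _ h => LabeledMultigraph.addLabel_congr h
  map_one' := mk_eq LabeledMultigraph.addLabel_edgeless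
  map_mul' := by
    rintro ⟨G⟩ ⟨H⟩
    exact mk_eq (LabeledMultigraph.addLabel_glue G H)

theorem degree_addLabel (G : GraphClass k) : degree (addLabel k G) = degree G := by
  rcases G with ⟨G⟩
  rfl

theorem unlabel_addLabel (G : GraphClass k) : unlabel (addLabel k G) = unlabel G * singleVertex := by
  rcases G with ⟨G⟩
  exact mk_eq (LabeledMultigraph.unlabel_addLabel G)

/-- The class of the fully labeled multigraph with given edge multiplicities. -/
def ofMult (k : ℕ) : Multiplicative (flatMult k) →* GraphClass k where
  toFun m := mk (LabeledMultigraph.ofMult m.toAdd)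
  map_one' := mk_eq ⟨Equiv.refl _, fun _ _ => rfl⟩
  map_mul' m n := (mk_eq (LabeledMultigraph.ofMult_add m.toAdd n.toAdd)).symm

/-- The fully labeled graph with a single edge between `i` and `j`. -/
def edge (i j : Fin k) : GraphClass k := ofMult k (.ofAdd (edgeMult k i j))

theorem degree_ofMult (m : Multiplicative (flatMult k)) : degree (ofMult k m) = 0 :=
  Nat.card_eq_zero.2 (Or.inl (inferInstanceAs (IsEmpty PEmpty)))

theorem degree_pow (G : GraphClass k) (n : ℕ) : degree (G ^ n) = n * degree G := by
  induction n with
  | zero => simp [degree_one]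
  | succ n ih => rw [pow_succ, degree_mul, ih]; ring

theorem mem_closure_edge {G : GraphClass k} (hG : degree G = 0) :
    G ∈ Submonoid.closure {H : GraphClass k | ∃ i j, i ≠ j ∧ H = edge i j} := by
  rcases G with ⟨G⟩
  obtain ⟨m, hm⟩ := LabeledMultigraph.exists_iso_ofMult hG
  rw [show Quot.mk _ G = ofMult k (.ofAdd m) from mk_eq hm]
  clear hm hG G
  induction LabeledMultigraph.flatMult_mem_closure m using AddSubmonoid.closure_induction with
  | mem n hn =>
    obtain ⟨i, j, h, rfl⟩ := hn
    exact Submonoid.subset_closure ⟨i, j, h, rfl⟩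
  | zero => exact (map_one (ofMult k)) ▸ one_mem _
  | add m n _ _ hm hn =>
    rw [ofAdd_add, map_mul]
    exact mul_mem hm hn

theorem exists_eq_unlabel (G : GraphClass 0) :
    ∃ (k : ℕ) (H : GraphClass k), degree H = 0 ∧ G = unlabel H := by
  rcases G with ⟨G⟩
  obtain ⟨k, m, hm⟩ := LabeledMultigraph.exists_iso_unlabel_ofMult G
  exact ⟨k, ofMult k (.ofAdd m), degree_ofMult _, mk_eq hm⟩

theorem mk_isolated (W : Type) [Finite W] :
    ∃ l, mk (LabeledMultigraph.isolated W) = singleVertex ^ l := by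
  -- The induction principle needs a motive on bare types, so finiteness is moved inside it.
  suffices h : ∀ [Finite W], ∃ l, mk (LabeledMultigraph.isolated W) = singleVertex ^ l from h
  refine Finite.induction_empty_option (P := fun W => ∀ [Finite W],
    ∃ l, mk (LabeledMultigraph.isolated W) = singleVertex ^ l) ?_ ?_ ?_ W
  · intro V W e ih _
    have := Finite.of_equiv W e.symm
    obtain ⟨l, hl⟩ := ih
    exact ⟨l, .trans (mk_eq (H := LabeledMultigraph.isolated V) ⟨e.symm, fun _ _ => rfl⟩) hl⟩
  · intro _
    exact ⟨0, (mk_eq ⟨Equiv.refl _, fun _ _ => rfl⟩).trans (pow_zero _).symm⟩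
  · intro W _ ih _
    obtain ⟨l, hl⟩ := ih
    refine ⟨l + 1, .trans (mk_eq (H := LabeledMultigraph.glue (LabeledMultigraph.isolated W)
      LabeledMultigraph.singleVertex) ⟨Equiv.optionEquivSumPUnit W, fun x y => ?_⟩)
      ((congrArg (· * singleVertex) hl).trans (pow_succ _ _).symm)⟩
    rcases x with x | _ | x
    · exact x.elim0
    all_goals
      rcases y with y | _ | y
      · exact y.elim0
      all_goals rfl

theorem unlabel_one (k : ℕ) : ∃ l, unlabel (1 : GraphClass k) = singleVertex ^ l := by
  obtain ⟨l, hl⟩ := mk_isolated (Fin k ⊕ PEmpty)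
  exact ⟨l, (mk_eq (G := LabeledMultigraph.unlabel (LabeledMultigraph.edgeless k))
    (H := LabeledMultigraph.isolated (Fin k ⊕ PEmpty)) ⟨Equiv.refl _, fun _ _ => rfl⟩).trans hl⟩

theorem unlabel_edge_pow {i j : Fin k} (h : i ≠ j) (n : ℕ) :
    ∃ l, unlabel (edge i j ^ n) = multiEdge n * singleVertex ^ l := by
  obtain ⟨l, hl⟩ := mk_isolated {x : Fin k // x ≠ i ∧ x ≠ j}
  refine ⟨l, .trans ?_ (congrArg _ hl)⟩
  rw [edge, ← map_pow]
  exact (mk_eq (LabeledMultigraph.unlabel_edgeMult h n)).symm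

theorem multiEdge_zero : ∃ l, multiEdge 0 = singleVertex ^ l := by
  obtain ⟨l, hl⟩ := mk_isolated Bool
  exact ⟨l, (mk_eq (G := LabeledMultigraph.multiEdge 0) (H := LabeledMultigraph.isolated Bool)
    ⟨Equiv.refl Bool, fun x y => (ite_self 0).symm⟩).trans hl⟩

end GraphClass

/-! ### Sums of squares in one variable -/

section SumOfSquares

variable {A : Type*} [CommRing A]

theorem IsSumSq.of_eq {a b : A} (hb : IsSumSq b) (h : a = b) : IsSumSq a :=
  h ▸ hb

theorem IsSumSq.map_ringHom {B : Type*} [CommRing B] (f : A →+* B) {a : A} (ha : IsSumSq a) :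
    IsSumSq (f a) := by
  induction ha with
  | zero => simp
  | sq_add a _ ih => exact map_add f _ _ ▸ map_mul f _ _ ▸ ih.sq_add _

/-- With s = r + t the element is (1 - y^{2r})(1 - y^{2t}) + y^{2t}. Each factor is 1 - y² times a
sum of squares, so the product is (1 - y²)² times a sum of squares. -/
theorem isSumSq_one_add_pow_sub_pow (y : A) {r s : ℕ} (h : r ≤ s) :
    IsSumSq (1 + y ^ (2 * s) - y ^ (2 * r)) := by
  obtain ⟨t, rfl⟩ := Nat.exists_eq_add_of_le h
  have hg (n : ℕ) : 1 - y ^ (2 * n) = (1 - y ^ 2) * ∑ i ∈ Finset.range n, (y ^ i) ^ 2 := by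
    simp_rw [← pow_mul, mul_comm _ 2, pow_mul, mul_neg_geom_sum]
  have : 1 + y ^ (2 * (r + t)) - y ^ (2 * r) =
      (1 - y ^ 2) * (1 - y ^ 2) * ((∑ i ∈ Finset.range r, (y ^ i) ^ 2) *
        ∑ i ∈ Finset.range t, (y ^ i) ^ 2) + y ^ t * y ^ t := by
    linear_combination (1 - y ^ (2 * t)) * hg r +
      ((1 - y ^ 2) * ∑ i ∈ Finset.range r, (y ^ i) ^ 2) * hg t
  rw [this]
  exact ((IsSumSq.mul_self _).mul ((IsSumSq.sum_sq _ _).mul (IsSumSq.sum_sq _ _))).add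
    (IsSumSq.mul_self _)

variable [Algebra ℝ A]

theorem IsSumSq.real_smul {a : A} (ha : IsSumSq a) {c : ℝ} (hc : 0 ≤ c) : IsSumSq (c • a) := by
  rw [← Real.mul_self_sqrt hc, Algebra.smul_def, map_mul]
  exact (IsSumSq.mul_self _).mul ha

/-- Here t = ±1. Start from (1 + t y^m)²/2. Since c y^N + (c/2)(1 - y^N)² = c/2 + (c/2) y^{2N}, each
further square halves the leading coefficient and doubles its exponent, while the constant stays
below 1. -/
theorem isSumSq_one_sub_add_pow (y : A) {t : ℝ} (ht : t * t = 1) (m k : ℕ) :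
    IsSumSq ((1 - (1 / 2 : ℝ) ^ (k + 1)) • 1 + (1 / 2 : ℝ) ^ (k + 1) • y ^ (2 * (2 ^ k * m)) +
      t • y ^ m) := by
  induction k with
  | zero =>
    refine ((IsSumSq.mul_self (1 + t • y ^ m)).real_smul
      (show (0 : ℝ) ≤ 1 / 2 by norm_num)).of_eq ?_
    have : (t • y ^ m) * (t • y ^ m) = y ^ (2 * m) := by
      rw [smul_mul_smul_comm, ht, one_smul, ← pow_add, two_mul]
    rw [add_mul, mul_add, mul_add, this]
    simp only [one_mul, mul_one, pow_zero, zero_add, pow_one]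
    module
  | succ k ih =>
    refine (ih.add ((IsSumSq.mul_self (1 - y ^ (2 * (2 ^ k * m)))).real_smul
      (show (0 : ℝ) ≤ (1 / 2) ^ (k + 2) by positivity))).of_eq ?_
    have : y ^ (2 * (2 ^ (k + 1) * m)) = y ^ (2 * (2 ^ k * m)) * y ^ (2 * (2 ^ k * m)) := by
      rw [← pow_add]
      congr 1
      ring
    rw [this, sub_mul, mul_sub, mul_sub]
    simp only [one_mul, mul_one, pow_succ]
    module

/-- Make the leading coefficient of the previous lemma at most ε, then raise its exponent to 2s. The
condition 2 ≤ s leaves room for the two labels of an edge. -/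
theorem exists_isSumSq_one_add_pow (y : A) {t : ℝ} (ht : t * t = 1) (m : ℕ) {ε : ℝ} (hε : 0 < ε) :
    ∃ s, 2 ≤ s ∧ IsSumSq (1 + t • y ^ m + ε • (1 + y ^ (2 * s))) := by
  obtain ⟨k, hk⟩ := exists_pow_lt_of_lt_one hε (show (1 / 2 : ℝ) < 1 by norm_num)
  have hc : (0 : ℝ) ≤ (1 / 2) ^ (k + 1) := by positivity
  have hc' : (1 / 2 : ℝ) ^ (k + 1) * 2 ≤ ε := by
    rw [pow_succ]
    linarith
  refine ⟨max (2 ^ k * m) 2, le_max_right _ _, ?_⟩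
  refine (((isSumSq_one_sub_add_pow y ht m k).add ((isSumSq_one_add_pow_sub_pow y
    (le_max_left (2 ^ k * m) 2)).real_smul hc)).add ((IsSumSq.one.real_smul hε.le).add
    ((IsSumSq.mul_self (y ^ max (2 ^ k * m) 2)).real_smul
      (sub_nonneg.2 (show (1 / 2 : ℝ) ^ (k + 1) ≤ ε by linarith))))).of_eq ?_
  rw [← pow_add, ← two_mul]
  module

end SumOfSquares

/-! ### Cones of sums of squares in the graph algebras -/

namespace GraphAlgebra

open MonoidAlgebra (of)

variable {k : ℕ}

@[simp]
theorem unlabel_of (G : GraphClass k) :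
    unlabel k (of ℝ _ G) = of ℝ _ (GraphClass.unlabel G) :=
  MonoidAlgebra.mapDomain_single

theorem of_mem_flat {G : GraphClass k} (hG : G.degree = 0) : of ℝ _ G ∈ flat k := by
  change of ℝ _ G ∈ MonoidAlgebra.supported ℝ ℝ _
  rw [MonoidAlgebra.supported_eq_span_single]
  exact Submodule.subset_span ⟨G, hG, rfl⟩

theorem of_mul_singleVertex_pow (G : GraphClass 0) (l : ℕ) :
    of ℝ _ (G * GraphClass.singleVertex ^ l) - of ℝ _ G ∈ isolatedVertexSpan := by
  induction l with
  | zero => simp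
  | succ l ih =>
    rw [pow_succ, ← mul_assoc, ← sub_add_sub_cancel _
      (of ℝ _ (G * GraphClass.singleVertex ^ l))]
    exact add_mem (Submodule.subset_span ⟨_, rfl⟩) ih

/-- Adding an isolated vertex with a new label, as a homomorphism of graph algebras. -/
def addLabel (k : ℕ) : GraphAlgebra k →ₐ[ℝ] GraphAlgebra (k + 1) :=
  MonoidAlgebra.mapDomainAlgHom ℝ ℝ (GraphClass.addLabel k)

theorem addLabel_of (G : GraphClass k) :
    addLabel k (of ℝ _ G) = of ℝ _ (GraphClass.addLabel k G) :=
  MonoidAlgebra.mapDomain_single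

theorem addLabel_mem_flat {a : GraphAlgebra k} (ha : a ∈ flat k) : addLabel k a ∈ flat (k + 1) := by
  change a ∈ MonoidAlgebra.supported ℝ ℝ _ at ha
  rw [MonoidAlgebra.supported_eq_span_single] at ha
  induction ha using Submodule.span_induction with
  | mem x hx =>
    obtain ⟨G, hG, rfl⟩ := hx
    exact addLabel_of G ▸ of_mem_flat ((GraphClass.degree_addLabel G).trans hG)
  | zero => simp
  | add x y _ _ hx hy => exact map_add (addLabel k) x y ▸ add_mem hx hy
  | smul c x _ hx => exact map_smul (addLabel k) c x ▸ Subalgebra.smul_mem _ hx c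

theorem unlabel_addLabel (a : GraphAlgebra k) :
    unlabel k a - unlabel (k + 1) (addLabel k a) ∈ isolatedVertexSpan := by
  induction a using MonoidAlgebra.induction_on with
  | of G =>
    rw [addLabel_of, unlabel_of, unlabel_of, GraphClass.unlabel_addLabel, ← neg_sub]
    exact neg_mem (Submodule.subset_span ⟨_, rfl⟩)
  | add x y hx hy =>
    simp only [map_add, add_sub_add_comm]
    exact add_mem hx hy
  | smul c x hx =>
    simp only [map_smul, ← smul_sub]
    exact Submodule.smul_mem _ c hx

/-- The quantum multigraphs that coincide with a sum of squares of flat elements with `r` labels. -/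
def sosCone (r : ℕ) : PointedCone ℝ QuantumMultigraph where
  carrier := {v | ∃ σ : flat r, IsSumSq σ ∧ Coincide v (σ : GraphAlgebra r)}
  zero_mem' := ⟨0, .zero, by simp [Coincide]⟩
  add_mem' := by
    rintro v w ⟨σ, hσ, hv⟩ ⟨τ, hτ, hw⟩
    refine ⟨σ + τ, hσ.add hτ, ?_⟩
    rw [Coincide, AddMemClass.coe_add, map_add, add_sub_add_comm]
    exact add_mem hv hw
  smul_mem' := by
    rintro ⟨c, hc⟩ v ⟨σ, hσ, hv⟩
    refine ⟨c • σ, hσ.real_smul hc, ?_⟩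
    change c • v - unlabel r (c • (σ : GraphAlgebra r)) ∈ _
    rw [map_smul, ← smul_sub]
    exact Submodule.smul_mem _ c hv

theorem real_smul_mem {C : PointedCone ℝ QuantumMultigraph} {v : QuantumMultigraph} (hv : v ∈ C)
    {c : ℝ} (hc : 0 ≤ c) : c • v ∈ C :=
  C.smul_mem hc hv

theorem unlabel_mem_sosCone {r : ℕ} {σ : flat r} (hσ : IsSumSq σ) :
    unlabel r (σ : GraphAlgebra r) ∈ sosCone r :=
  ⟨σ, hσ, by simp [Coincide]⟩

theorem mem_sosCone_of_mem_isolatedVertexSpan (r : ℕ) {v : QuantumMultigraph}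
    (hv : v ∈ isolatedVertexSpan) : v ∈ sosCone r :=
  ⟨0, .zero, by simpa [Coincide] using hv⟩

theorem mem_sosCone_congr {r : ℕ} {v w : QuantumMultigraph} (hw : w ∈ sosCone r)
    (h : v - w ∈ isolatedVertexSpan) : v ∈ sosCone r :=
  sub_add_cancel v w ▸ add_mem (mem_sosCone_of_mem_isolatedVertexSpan r h) hw

/-- Adding an isolated labeled vertex is an algebra homomorphism, so it preserves sums of squares;
after forgetting labels only an isolated vertex has been added. -/
theorem sosCone_mono : Monotone sosCone := by
  refine monotone_nat_of_le_succ fun r v hv => ?_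
  obtain ⟨σ, hσ, hv⟩ := hv
  refine ⟨((addLabel r).comp (flat r).val).codRestrict (flat (r + 1))
    (fun a => addLabel_mem_flat a.2) σ, hσ.map_ringHom (AlgHom.toRingHom _), ?_⟩
  have := add_mem hv (unlabel_addLabel (σ : GraphAlgebra r))
  rwa [sub_add_sub_cancel] at this

/-- The fully labeled graph algebra element with a single edge between two labeled vertices. -/
def flatEdge : flat 2 := ⟨of ℝ _ (GraphClass.edge 0 1), of_mem_flat (GraphClass.degree_ofMult _)⟩

/-- Evaluates a polynomial at the multiple `1 / d` of a labeled edge and forgets the labels. -/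
def edgeEval (d : ℝ) : Polynomial ℝ →ₗ[ℝ] QuantumMultigraph :=
  unlabel 2 ∘ₗ (flat 2).val.toLinearMap ∘ₗ (Polynomial.aeval ((1 / d) • flatEdge)).toLinearMap

/-- Powers of a labeled edge are multiple edges. This carries one-variable identities over to
statements about K_2^m. -/
theorem edgeEval_X_pow (d : ℝ) (m : ℕ) :
    (1 / d ^ m) • of ℝ _ (GraphClass.multiEdge m) - edgeEval d (Polynomial.X ^ m) ∈
      isolatedVertexSpan := by
  obtain ⟨l, hl⟩ := GraphClass.unlabel_edge_pow (show (0 : Fin 2) ≠ 1 by decide) m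
  have : edgeEval d (Polynomial.X ^ m) =
      (1 / d ^ m) • of ℝ _ (GraphClass.multiEdge m * GraphClass.singleVertex ^ l) := by
    rw [← hl, ← unlabel_of, map_pow (of ℝ (GraphClass 2)), ← map_smul, ← one_div_pow, ← smul_pow]
    change unlabel 2 ((flat 2).val (Polynomial.aeval ((1 / d) • flatEdge) (Polynomial.X ^ m))) = _
    rw [map_pow, map_pow, Polynomial.aeval_X, map_smul]
    rfl
  rw [this, ← smul_sub, ← neg_sub]
  exact Submodule.smul_mem _ _ (neg_mem (of_mul_singleVertex_pow _ _))

theorem edgeEval_one (d : ℝ) : 1 - edgeEval d 1 ∈ isolatedVertexSpan := by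
  obtain ⟨l, hl⟩ := GraphClass.multiEdge_zero
  have h := edgeEval_X_pow d 0
  rw [pow_zero, pow_zero, hl, div_one, one_smul] at h
  have := sub_mem h (of_mul_singleVertex_pow 1 l)
  rwa [one_mul, map_one (of ℝ (GraphClass 0)), sub_sub_sub_cancel_left] at this

theorem edgeEval_mem_sosCone (d : ℝ) {p : Polynomial ℝ} (hp : IsSumSq p) {r : ℕ} (hr : 2 ≤ r) :
    edgeEval d p ∈ sosCone r :=
  sosCone_mono hr (unlabel_mem_sosCone (hp.map_ringHom (Polynomial.aeval ((1 / d) • flatEdge)).toRingHom))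

/-- The quantum multigraph `1 + d^{-2r} K_2^{2r}`. -/
def edgeBound (d : ℝ) (r : ℕ) : QuantumMultigraph :=
  1 + (1 / d ^ (2 * r)) • of ℝ (GraphClass 0) (GraphClass.multiEdge (2 * r))

theorem edgeBound_sub_edgeEval (d : ℝ) (r : ℕ) :
    edgeBound d r - edgeEval d (1 + Polynomial.X ^ (2 * r)) ∈ isolatedVertexSpan := by
  rw [edgeBound, map_add, add_sub_add_comm]
  exact add_mem (edgeEval_one d) (edgeEval_X_pow d _)

/-- Comes from 2(1 + x^{2s}) - (1 + x^{2r}) = (1 + x^{2s} - x^{2r}) + x^{2s}. Hence r can be raised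
to s at the cost of a factor 2, which is harmless because ε is arbitrary. -/
theorem two_smul_edgeBound_sub_mem (d : ℝ) {r s : ℕ} (hrs : r ≤ s) (hs : 2 ≤ s) :
    (2 : ℝ) • edgeBound d s - edgeBound d r ∈ sosCone s := by
  refine mem_sosCone_congr (edgeEval_mem_sosCone d (p := (2 : ℝ) • (1 + Polynomial.X ^ (2 * s)) -
    (1 + Polynomial.X ^ (2 * r))) ?_ hs) ?_
  · refine ((isSumSq_one_add_pow_sub_pow (Polynomial.X : Polynomial ℝ) hrs).add
      (IsSumSq.mul_self (Polynomial.X ^ s))).of_eq ?_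
    rw [two_smul]
    ring
  · rw [map_sub, map_smul, sub_sub_sub_comm, ← smul_sub]
    exact sub_mem (Submodule.smul_mem _ _ (edgeBound_sub_edgeEval d s)) (edgeBound_sub_edgeEval d r)

theorem edgeBound_sub_one_mem (d : ℝ) {s : ℕ} (hs : 2 ≤ s) : edgeBound d s - 1 ∈ sosCone s := by
  rw [edgeBound, add_sub_cancel_left]
  refine mem_sosCone_congr (edgeEval_mem_sosCone d (IsSumSq.mul_self (Polynomial.X ^ s)) hs) ?_
  rw [← pow_add, ← two_mul]
  exact edgeEval_X_pow d _

theorem add_smul_edgeBound_mem {d : ℝ} {v : QuantumMultigraph} {ε : ℝ} (hε : 0 ≤ ε) {r s : ℕ}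
    (hv : v + ε • edgeBound d r ∈ sosCone r) (hrs : r ≤ s) (hs : 2 ≤ s) :
    v + (2 * ε) • edgeBound d s ∈ sosCone s := by
  convert add_mem (sosCone_mono hrs hv)
    (real_smul_mem (two_smul_edgeBound_sub_mem d hrs hs) hε) using 1
  module

theorem edgeBound_mem_sosCone (d : ℝ) {s : ℕ} (hs : 2 ≤ s) : edgeBound d s ∈ sosCone s := by
  convert two_smul_edgeBound_sub_mem d le_rfl hs using 1
  module

/-- The quantum multigraphs approximated by sums of squares of flat elements. -/
def approxCone (d : ℝ) : PointedCone ℝ QuantumMultigraph where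
  carrier := {v | ∀ ε : ℝ, 0 < ε → ∃ r, v + ε • edgeBound d r ∈ sosCone r}
  zero_mem' ε hε := by
    exact ⟨2, add_mem (zero_mem _) (real_smul_mem (edgeBound_mem_sosCone d le_rfl) hε.le)⟩
  add_mem' := by
    intro v w hv hw ε hε
    -- Passing to a common index doubles each error, and there are two of them.
    obtain ⟨r, hr⟩ := hv (ε / 4) (by positivity)
    obtain ⟨s, hs⟩ := hw (ε / 4) (by positivity)
    have hε' : 0 ≤ ε / 4 := by positivity
    refine ⟨max (max r s) 2, ?_⟩
    convert add_mem (add_smul_edgeBound_mem hε' hr ((le_max_left r s).trans (le_max_left _ 2))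
      (le_max_right _ _)) (add_smul_edgeBound_mem hε' hs
      ((le_max_right r s).trans (le_max_left _ 2)) (le_max_right _ _)) using 1
    module
  smul_mem' := by
    rintro ⟨c, hc⟩ v hv ε hε
    have hc' : 0 < c + 1 := by positivity
    -- After doubling and scaling by c the error is cε/(c + 1); the missing ε/(c + 1) is filled with
    -- `edgeBound` itself. Using c + 1 covers c = 0.
    obtain ⟨r, hr⟩ := hv (ε / (c + 1) / 2) (by positivity)
    refine ⟨max r 2, ?_⟩
    have h := add_mem (real_smul_mem (add_smul_edgeBound_mem (by positivity) hr (le_max_left r 2)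
      (le_max_right r 2)) hc) (real_smul_mem (edgeBound_mem_sosCone d (le_max_right r 2))
        (show 0 ≤ ε / (c + 1) by positivity))
    have he : c * (2 * (ε / (c + 1) / 2)) + ε / (c + 1) = ε := by field_simp
    rw [smul_add, smul_smul, add_assoc, ← add_smul, he] at h
    exact h

theorem sosCone_le_approxCone (d : ℝ) (r : ℕ) : sosCone r ≤ approxCone d := by
  intro v hv ε hε
  refine ⟨max r 2, add_mem (sosCone_mono (le_max_left r 2) hv)
    (real_smul_mem (edgeBound_mem_sosCone d (le_max_right r 2)) hε.le)⟩

theorem mem_approxCone_of_forall_add {d : ℝ} {v : QuantumMultigraph}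
    (hv : ∀ ε : ℝ, 0 < ε → v + ε • 1 ∈ approxCone d) : v ∈ approxCone d := by
  intro ε hε
  -- One third replaces the multiple of 1 by `edgeBound`; the other error becomes two thirds when
  -- the index is raised.
  obtain ⟨r, hr⟩ := hv (ε / 3) (by positivity) (ε / 3) (by positivity)
  refine ⟨max r 2, ?_⟩
  convert add_mem (add_smul_edgeBound_mem (by positivity) hr (le_max_left r 2) (le_max_right r 2))
    (real_smul_mem (edgeBound_sub_one_mem d (le_max_right r 2)) (show 0 ≤ ε / 3 by positivity))
    using 1
  module

/-- With t = ±1 this is the inequality |K_2^m| ≤ d^m in the order of the cone. -/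
theorem one_add_smul_multiEdge_mem (d : ℝ) {t : ℝ} (ht : t * t = 1) (m : ℕ) :
    1 + t • (1 / d ^ m) • of ℝ _ (GraphClass.multiEdge m) ∈ approxCone d := by
  intro ε hε
  obtain ⟨s, hs, h⟩ := exists_isSumSq_one_add_pow (Polynomial.X : Polynomial ℝ) ht m hε
  refine ⟨s, mem_sosCone_congr (edgeEval_mem_sosCone d h hs) ?_⟩
  rw [(edgeEval d).map_add (1 + _) (ε • _), (edgeEval d).map_add 1 (t • _), (edgeEval d).map_smul t,
    (edgeEval d).map_smul ε, add_sub_add_comm, add_sub_add_comm, ← smul_sub, ← smul_sub]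
  exact add_mem (add_mem (edgeEval_one d) (Submodule.smul_mem _ _ (edgeEval_X_pow d m)))
    (Submodule.smul_mem _ _ (edgeBound_sub_edgeEval d s))

end GraphAlgebra

/-! ### Separation by M. Riesz extension -/

/-- A vector outside a convex cone with an order unit is separated from the cone by a normalized
positive functional. -/
theorem PointedCone.exists_linearMap_nonpos {E : Type*} [AddCommGroup E] [Module ℝ E]
    (K : PointedCone ℝ E) {e : E} (he : e ∈ K) (hunit : ∀ v, ∃ c : ℝ, c • e + v ∈ K) {a : E}
    (ha : a ∉ K) : ∃ L : E →ₗ[ℝ] ℝ, (∀ v ∈ K, 0 ≤ L v) ∧ L e = 1 ∧ L a ≤ 0 := by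
  -- A negative multiple of the order unit in `K` would put every vector, in particular `a`, into
  -- `K`.
  have hneg {c : ℝ} (hc : c < 0) : c • e ∉ K := by
    intro h
    obtain ⟨b, hb⟩ := hunit a
    refine ha ?_
    have h' := add_mem (K.smul_mem (show 0 ≤ |b| / -c from
      div_nonneg (abs_nonneg b) (neg_nonneg.2 hc.le)) h) (add_mem
      (K.smul_mem (sub_nonneg.2 (le_abs_self b)) he) hb)
    have hb' : |b| / -c * c = -|b| := by
      rw [div_neg, neg_mul, div_mul_cancel₀ _ hc.ne]
    rw [smul_smul, hb'] at h'
    convert h' using 1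
    module
  have he0 : e ≠ 0 := by
    rintro rfl
    exact hneg neg_one_lt_zero (by simp)
  -- The cone generated by `K` and `-a`; positivity on it forces `L a ≤ 0`.
  let K' : PointedCone ℝ E :=
    { carrier := {v | ∃ l : ℝ, 0 ≤ l ∧ v + l • a ∈ K}
      zero_mem' := ⟨0, le_rfl, by simp⟩
      add_mem' := by
        rintro v w ⟨l, hl, hv⟩ ⟨m, hm, hw⟩
        refine ⟨l + m, add_nonneg hl hm, ?_⟩
        convert add_mem hv hw using 1
        module
      smul_mem' := by
        rintro ⟨c, hc⟩ v ⟨l, hl, hv⟩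
        refine ⟨c * l, mul_nonneg hc hl, ?_⟩
        convert K.smul_mem hc hv using 1
        rw [smul_add, smul_smul]
        rfl }
  have hK {v : E} (hv : v ∈ K) : v ∈ K' := ⟨0, le_rfl, by simpa using hv⟩
  let f : E →ₗ.[ℝ] ℝ := LinearPMap.mkSpanSingleton e 1 he0
  have nonneg (v : f.domain) (hvK : (v : E) ∈ K') : 0 ≤ f v := by
    obtain ⟨v, hv⟩ := v
    obtain ⟨c, rfl⟩ := Submodule.mem_span_singleton.1 hv
    rw [show f ⟨c • e, hv⟩ = c • (1 : ℝ) from LinearPMap.mkSpanSingleton'_apply .., smul_eq_mul, mul_one]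
    obtain ⟨l, hl, hla⟩ := hvK
    by_contra! hc
    rcases hl.eq_or_lt with rfl | hl
    · rw [zero_smul, add_zero] at hla
      exact hneg hc hla
    -- Adding the positive multiple `(-c) • e` leaves `l • a` in `K`, hence `a` in `K`.
    · refine ha ?_
      have h := K.smul_mem (inv_nonneg.2 hl.le) (add_mem hla (K.smul_mem (neg_nonneg.2 hc.le) he))
      have h' : c • e + l • a + (-c) • e = l • a := by module
      rwa [h', inv_smul_smul₀ hl.ne'] at h
  have dense (v : E) : ∃ x : f.domain, (x : E) + v ∈ K' := by
    obtain ⟨c, hc⟩ := hunit v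
    exact ⟨⟨c • e, Submodule.smul_mem _ c (Submodule.mem_span_singleton_self e)⟩, hK hc⟩
  obtain ⟨L, hL, hL'⟩ := riesz_extension K' f nonneg dense
  refine ⟨L, fun v hv => hL' v (hK hv), ?_, ?_⟩
  · rw [hL ⟨e, Submodule.mem_span_singleton_self e⟩]
    exact LinearPMap.mkSpanSingleton_apply ℝ ℝ he0 1
  · have : -a ∈ K' := ⟨1, zero_le_one, by simp⟩
    simpa using hL' _ this

/-! ### The empty graph is an order unit -/

namespace GraphAlgebra

open MonoidAlgebra (of)

theorem one_mem_approxCone (d : ℝ) : (1 : QuantumMultigraph) ∈ approxCone d :=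
  sosCone_le_approxCone d 2 (mem_sosCone_congr (edgeEval_mem_sosCone d IsSumSq.one le_rfl)
    (edgeEval_one d))

/-- The quantum multigraphs bounded by a multiple of the empty graph. -/
def boundedSubmodule (d : ℝ) : Submodule ℝ QuantumMultigraph where
  carrier := {v | ∃ c : ℝ, ∀ t : ℝ, t * t = 1 → c • 1 + t • v ∈ approxCone d}
  zero_mem' := ⟨0, fun t _ => by simp⟩
  add_mem' := by
    rintro v w ⟨b, hv⟩ ⟨c, hw⟩
    refine ⟨b + c, fun t ht => ?_⟩
    convert add_mem (hv t ht) (hw t ht) using 1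
    module
  smul_mem' := by
    rintro a v ⟨c, hv⟩
    refine ⟨|a| * c, fun t ht => ?_⟩
    rcases abs_cases a with ⟨h, _⟩ | ⟨h, _⟩
    · convert real_smul_mem (hv t ht) (abs_nonneg a) using 1
      rw [h]
      module
    · convert real_smul_mem (hv (-t) (by rw [neg_mul_neg, ht])) (abs_nonneg a) using 1
      rw [h]
      module

theorem mem_boundedSubmodule_of_mem_isolatedVertexSpan (d : ℝ) {v : QuantumMultigraph}
    (hv : v ∈ isolatedVertexSpan) : v ∈ boundedSubmodule d :=
  ⟨0, fun t _ => sosCone_le_approxCone d 0 (mem_sosCone_of_mem_isolatedVertexSpan 0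
    (by rw [zero_smul, zero_add]; exact Submodule.smul_mem _ t hv))⟩

theorem one_mem_boundedSubmodule (d : ℝ) : of ℝ (GraphClass 0) 1 ∈ boundedSubmodule d := by
  refine ⟨1, fun t ht => ?_⟩
  rw [map_one, ← add_smul]
  exact real_smul_mem (one_mem_approxCone d) (by nlinarith)

variable {d : ℝ}

theorem of_mul_singleVertex_pow_mem_boundedSubmodule {G : GraphClass 0}
    (hG : of ℝ _ G ∈ boundedSubmodule d) (l : ℕ) :
    of ℝ _ (G * GraphClass.singleVertex ^ l) ∈ boundedSubmodule d :=
  sub_add_cancel (of ℝ _ (G * GraphClass.singleVertex ^ l)) (of ℝ _ G) ▸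
    add_mem (mem_boundedSubmodule_of_mem_isolatedVertexSpan d (of_mul_singleVertex_pow G l)) hG

theorem multiEdge_mem_boundedSubmodule (hd : 0 < d) (m : ℕ) :
    of ℝ _ (GraphClass.multiEdge m) ∈ boundedSubmodule d := by
  have h : (1 / d ^ m) • of ℝ _ (GraphClass.multiEdge m) ∈ boundedSubmodule d :=
    ⟨1, fun t ht => by simpa only [one_smul] using one_add_smul_multiEdge_mem d ht m⟩
  exact (Submodule.smul_mem_iff _ (one_div_pos.2 (pow_pos hd m)).ne').1 h

/-- Cauchy–Schwarz: for t = ±1 the square (G + tH)² = G² + 2tGH + H² lies in the cone, so bounds for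
G² and H² give one for GH. -/
theorem unlabel_mul_mem_boundedSubmodule {k : ℕ} {G H : GraphClass k} (hG : G.degree = 0)
    (hH : H.degree = 0) (hGG : of ℝ _ (GraphClass.unlabel (G * G)) ∈ boundedSubmodule d)
    (hHH : of ℝ _ (GraphClass.unlabel (H * H)) ∈ boundedSubmodule d) :
    of ℝ _ (GraphClass.unlabel (G * H)) ∈ boundedSubmodule d := by
  obtain ⟨b, hb⟩ := hGG
  obtain ⟨c, hc⟩ := hHH
  refine ⟨(b + c) / 2, fun t ht => ?_⟩
  let x : flat k := ⟨of ℝ _ G, of_mem_flat hG⟩ + t • ⟨of ℝ _ H, of_mem_flat hH⟩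
  have hx : unlabel k ((x * x : flat k) : GraphAlgebra k) = of ℝ _ (GraphClass.unlabel (G * G)) +
      (2 * t) • of ℝ _ (GraphClass.unlabel (G * H)) + of ℝ _ (GraphClass.unlabel (H * H)) := by
    change unlabel k ((of ℝ _ G + t • of ℝ _ H) * (of ℝ _ G + t • of ℝ _ H)) = _
    rw [add_mul, mul_add, mul_add, smul_mul_smul_comm, ht, smul_mul_assoc, mul_smul_comm,
      mul_comm (of ℝ _ H)]
    simp only [← map_mul (of ℝ (GraphClass k)), map_add, map_smul, unlabel_of]
    module
  have hxK := sosCone_le_approxCone d k (unlabel_mem_sosCone (IsSumSq.mul_self x))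
  rw [hx] at hxK
  convert real_smul_mem (add_mem (add_mem (hb (-1) (by norm_num)) (hc (-1) (by norm_num))) hxK)
    (show (0 : ℝ) ≤ 1 / 2 by norm_num) using 1
  module

theorem boundedSubmodule_eq_top (hd : 0 < d) : boundedSubmodule d = ⊤ := by
  refine Submodule.eq_top_iff'.2 fun v => ?_
  induction v using MonoidAlgebra.induction_on with
  | add x y hx hy => exact add_mem hx hy
  | smul c x hx => exact Submodule.smul_mem _ c hx
  | of G =>
  obtain ⟨k, H, hH, rfl⟩ := GraphClass.exists_eq_unlabel G
  -- All powers are treated at once: bounding (GK)^n = G^n K^n uses the bounds for G^{2n} and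
  -- K^{2n}. Degree 0 is carried along because the squares must be flat.
  suffices h : H.degree = 0 ∧
      ∀ n, of ℝ _ (GraphClass.unlabel (H ^ n)) ∈ boundedSubmodule d from pow_one H ▸ h.2 1
  have hcl := GraphClass.mem_closure_edge hH
  clear hH
  induction hcl using Submonoid.closure_induction with
  | mem K hK =>
    obtain ⟨i, j, hij, rfl⟩ := hK
    refine ⟨GraphClass.degree_ofMult _, fun n => ?_⟩
    obtain ⟨l, hl⟩ := GraphClass.unlabel_edge_pow hij n
    exact hl ▸ of_mul_singleVertex_pow_mem_boundedSubmodule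
      (multiEdge_mem_boundedSubmodule hd n) l
  | one =>
    refine ⟨GraphClass.degree_one, fun n => ?_⟩
    obtain ⟨l, hl⟩ := GraphClass.unlabel_one k
    rw [one_pow, hl, ← one_mul (_ ^ l)]
    exact of_mul_singleVertex_pow_mem_boundedSubmodule (one_mem_boundedSubmodule d) l
  | mul G K _ _ hG hK =>
    refine ⟨by rw [GraphClass.degree_mul, hG.1, hK.1], fun n => ?_⟩
    rw [mul_pow]
    refine unlabel_mul_mem_boundedSubmodule (by rw [GraphClass.degree_pow, hG.1, mul_zero])
      (by rw [GraphClass.degree_pow, hK.1, mul_zero]) ?_ ?_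
    · exact pow_add G n n ▸ hG.2 _
    · exact pow_add K n n ▸ hK.2 _

end GraphAlgebra

/-! ### Graph parameters and positive functionals -/

namespace GraphParameter

open MonoidAlgebra (of)

theorem eval_of (t : GraphParameter) (G : GraphClass 0) : t.eval (of ℝ _ G) = t G := by
  change Finsupp.linearCombination ℝ t (Finsupp.single G 1) = t G
  simp

theorem IsolateIndifferent.eval_eq_zero {t : GraphParameter} (ht : t.IsolateIndifferent)
    {v : QuantumMultigraph} (hv : v ∈ GraphAlgebra.isolatedVertexSpan) : t.eval v = 0 := by
  refine (Submodule.span_le (p := LinearMap.ker t.eval)).2 ?_ hv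
  rintro _ ⟨G, rfl⟩
  change t.eval (_ - _) = 0
  rw [map_sub, eval_of, eval_of, ht, sub_self]

theorem FlatlyReflectionPositive.eval_nonneg {t : GraphParameter}
    (ht : t.FlatlyReflectionPositive) {k : ℕ} {σ : GraphAlgebra.flat k} (hσ : IsSumSq σ) :
    0 ≤ t.eval (GraphAlgebra.unlabel k (σ : GraphAlgebra k)) := by
  induction hσ with
  | zero => simp
  | sq_add a _ ih =>
    rw [AddMemClass.coe_add, map_add, map_add]
    refine add_nonneg ?_ ih
    have := ht k a a.2
    rwa [pow_two] at this

theorem Bounded.eval_edgeBound_le {d : ℝ} (hd : 0 < d) {t : GraphParameter} (hb : t.Bounded d)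
    (hi : t.IsolateIndifferent) (r : ℕ) : t.eval (GraphAlgebra.edgeBound d r) ≤ 2 := by
  -- The empty graph and K_2^0 differ only by isolated vertices, so the bound d^0 = 1 applies.
  have h0 : t.eval 1 ≤ 1 := by
    have h := hi.eval_eq_zero (sub_mem (GraphAlgebra.edgeEval_one d)
      (pow_zero (Polynomial.X : Polynomial ℝ) ▸ GraphAlgebra.edgeEval_X_pow d 0))
    rw [sub_sub_sub_cancel_right, map_sub, map_smul, eval_of, pow_zero, div_one, one_smul] at h
    have := (le_abs_self _).trans (hb 0)
    rw [pow_zero] at this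
    linarith
  have h1 : (1 / d ^ (2 * r)) * t (GraphClass.multiEdge (2 * r)) ≤ 1 := by
    rw [one_div_mul_eq_div, div_le_one (by positivity)]
    exact (le_abs_self _).trans (hb _)
  rw [GraphAlgebra.edgeBound, map_add, map_smul, eval_of, smul_eq_mul]
  linarith

/-- The graph parameter given by the values of a linear functional. -/
def ofLinearMap (L : QuantumMultigraph →ₗ[ℝ] ℝ) : GraphParameter := fun G => L (of ℝ _ G)

theorem eval_ofLinearMap (L : QuantumMultigraph →ₗ[ℝ] ℝ) (v : QuantumMultigraph) :
    (ofLinearMap L).eval v = L v := by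
  induction v using MonoidAlgebra.induction_on with
  | of G => exact eval_of _ G
  | add x y hx hy => rw [map_add, map_add, hx, hy]
  | smul c x hx => rw [map_smul, map_smul, hx]

variable {d : ℝ} {L : QuantumMultigraph →ₗ[ℝ] ℝ}

/-- `isolatedVertexSpan` is a linear subspace inside the cone, so L is nonnegative on it and on its
negatives, hence zero. -/
theorem isolateIndifferent_ofLinearMap (hL : ∀ v ∈ GraphAlgebra.approxCone d, 0 ≤ L v) :
    (ofLinearMap L).IsolateIndifferent := by
  intro G
  have hG := Submodule.subset_span (R := ℝ) (Set.mem_range_self (f := fun G : GraphClass 0 =>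
    of ℝ (GraphClass 0) (G * GraphClass.singleVertex) - of ℝ (GraphClass 0) G) G)
  have hpos {v : QuantumMultigraph} (hv : v ∈ GraphAlgebra.isolatedVertexSpan) : 0 ≤ L v :=
    hL v (GraphAlgebra.sosCone_le_approxCone d 0
      (GraphAlgebra.mem_sosCone_of_mem_isolatedVertexSpan 0 hv))
  have h1 := hpos hG
  have h2 := hpos (neg_mem hG)
  rw [map_neg] at h2
  rw [map_sub] at h1 h2
  change L _ = L _
  linarith

theorem flatlyReflectionPositive_ofLinearMap (hL : ∀ v ∈ GraphAlgebra.approxCone d, 0 ≤ L v) :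
    (ofLinearMap L).FlatlyReflectionPositive := by
  intro k a ha
  rw [eval_ofLinearMap, pow_two]
  have h := GraphAlgebra.unlabel_mem_sosCone (IsSumSq.mul_self (⟨a, ha⟩ : GraphAlgebra.flat k))
  rw [MulMemClass.coe_mul] at h
  exact hL _ (GraphAlgebra.sosCone_le_approxCone d k h)

theorem bounded_ofLinearMap (hd : 0 < d) (hL : ∀ v ∈ GraphAlgebra.approxCone d, 0 ≤ L v)
    (hL1 : L 1 = 1) : (ofLinearMap L).Bounded d := by
  intro m
  have h {t : ℝ} (ht : t * t = 1) : 0 ≤ 1 + t * (1 / d ^ m * ofLinearMap L (.multiEdge m)) := by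
    have := hL _ (GraphAlgebra.one_add_smul_multiEdge_mem d ht m)
    rwa [map_add, map_smul, map_smul, hL1] at this
  have h1 := h (one_mul 1)
  have h2 := h (t := -1) (by norm_num)
  have : |1 / d ^ m * ofLinearMap L (.multiEdge m)| ≤ 1 := abs_le.2 ⟨by linarith, by linarith⟩
  rwa [abs_mul, abs_of_pos (one_div_pos.2 (pow_pos hd m)), one_div_mul_eq_div,
    div_le_one (pow_pos hd m)] at this

end GraphParameter

end

/-! ### The equivalence -/

theorem theorem3p7 (d : ℝ) (hd : 0 < d) (a : QuantumMultigraph) :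
    (∀ t : GraphParameter, t.IsolateIndifferent → t.FlatlyReflectionPositive → t.Bounded d →
        0 ≤ t.eval a) ↔
      ∀ ε : ℝ, 0 < ε → ∃ r : ℕ, ∃ σ : GraphAlgebra.flat r, IsSumSq σ ∧
        GraphAlgebra.Coincide
          (a + ε • (1 + (1 / d ^ (2 * r)) •
            MonoidAlgebra.of ℝ (GraphClass 0) (GraphClass.multiEdge (2 * r))))
          (σ : GraphAlgebra r) := by
  constructor
  · intro h
    change a ∈ GraphAlgebra.approxCone d
    -- Separation gives only a weak inequality; the shift by ε·1 turns it into `L a ≤ -ε < 0`.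
    refine GraphAlgebra.mem_approxCone_of_forall_add fun ε hε => ?_
    by_contra ha
    obtain ⟨L, hL, hL1, hLa⟩ := PointedCone.exists_linearMap_nonpos (GraphAlgebra.approxCone d)
      (GraphAlgebra.one_mem_approxCone d) (fun v => by
        obtain ⟨c, hc⟩ : v ∈ GraphAlgebra.boundedSubmodule d :=
          GraphAlgebra.boundedSubmodule_eq_top hd ▸ Submodule.mem_top
        exact ⟨c, by simpa only [one_smul] using hc 1 (one_mul 1)⟩) ha
    have hLpos := h (.ofLinearMap L) (GraphParameter.isolateIndifferent_ofLinearMap hL)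
      (GraphParameter.flatlyReflectionPositive_ofLinearMap hL)
      (GraphParameter.bounded_ofLinearMap hd hL hL1)
    rw [GraphParameter.eval_ofLinearMap] at hLpos
    rw [map_add, map_smul, hL1, smul_eq_mul, mul_one] at hLa
    linarith
  · intro h t hi hp hb
    refine le_of_forall_pos_le_add fun ε hε => ?_
    -- The factor 1/2 offsets the bound 2 on the value of `edgeBound`.
    obtain ⟨r, σ, hσ, hc⟩ := h (ε / 2) (by positivity)
    have h0 := hi.eval_eq_zero hc
    change t.eval (a + (ε / 2) • GraphAlgebra.edgeBound d r - _) = 0 at h0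
    rw [map_sub, map_add, map_smul, smul_eq_mul] at h0
    nlinarith [hp.eval_nonneg hσ, hb.eval_edgeBound_le hd hi r]
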